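/- Let $m,n\ge 1$, let $A,C\in\mathbb C^{m\times m}$, $B,D\in\mathbb C^{n\times n}$ and $E\in\mathbb C^{m\times n}$, and let $\overline M$ denote the entrywise complex conjugate of a matrix $M$. A square matrix pencil $M+\lambda N$ is called regular if the polynomial $\det(M+\lambda N)$ in $\lambda$ is not identically zero; the spectrum of a regular pencil is the set of its eigenvalues in $\mathbb C\cup\{\infty\}$, where $\lambda_0\in\mathbb C$ is an eigenvalue if $\det(M+\lambda_0N)=0$, and $\infty$ is an eigenvalue if $N$ is not invertible. Then the generalized conjugate-Sylvester equation $$AXB-C\overline XD=E$$ has a unique solution $X\in\mathbb C^{m\times n}$ if and only if the two pencils $$\begin{bmatrix}\lambda\overline C&\overline A\\ A&\lambda C\end{bmatrix}\qquad\text{and}\qquad\begin{bmatrix}\lambda\overline B&D\\ \overline D&\lambda B\end{bmatrix}$$ are regular and have disjoint spectra. -/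

import Mathlib

open scoped Polynomial

/-- The square matrix pencil `M + λ N` with complex coefficients, recorded by its two coefficient
matrices: `M` is the constant coefficient, `N` is the coefficient of `λ`. -/
structure MatrixPencil (ι : Type*) where
  M : Matrix ι ι ℂ
  N : Matrix ι ι ℂ

namespace MatrixPencil

variable {ι : Type*}

/-- The value `M + z N` of the pencil at the complex number `z`. -/
def eval (P : MatrixPencil ι) (z : ℂ) : Matrix ι ι ℂ := P.M + z • P.N

/-- The pencil `M + λ N` as a matrix of polynomials in `λ`. -/
noncomputable def toPolyMatrix (P : MatrixPencil ι) : Matrix ι ι ℂ[X] :=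
  P.M.map Polynomial.C + (Polynomial.X : ℂ[X]) • P.N.map Polynomial.C

variable [Fintype ι] [DecidableEq ι]

/-- A square pencil is regular if its determinant is not the zero polynomial. -/
def IsRegular (P : MatrixPencil ι) : Prop := P.toPolyMatrix.det ≠ 0

/-- The spectrum, as a subset of `ℂ ∪ {∞}`: a number `z` is an eigenvalue when `M + z N` has
determinant zero, and `∞` is an eigenvalue when `N` is not invertible. (This is the notion of
spectrum of a regular pencil.) -/
def spectrum (P : MatrixPencil ι) : Set (OnePoint ℂ) :=
  {x | (∃ z : ℂ, x = (z : OnePoint ℂ) ∧ (P.eval z).det = 0) ∨ (x = OnePoint.infty ∧ ¬ IsUnit P.N)}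

end MatrixPencil

/-- The entrywise complex conjugate of a matrix (no transposition). -/
def Matrix.entrywiseConj {m n : Type*} (A : Matrix m n ℂ) : Matrix m n ℂ :=
  A.map (starRingEnd ℂ)

open Matrix in
/-- The pencil `[[λ S̄, T], [T', λ S]]` with all blocks square of the same size. -/
def conjBlockPencil {ι : Type*} (S T T' : Matrix ι ι ℂ) : MatrixPencil (ι ⊕ ι) where
  M := fromBlocks 0 T T' 0
  N := fromBlocks S.entrywiseConj 0 0 S

/-!
The equation is real-linear in `X` on a finite-dimensional space, so it is uniquely solvable for
every right-hand side (equivalently, for one) exactly when the homogeneous equation has only the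
zero solution. Replacing `X̄` by an independent unknown `Y` complexifies the homogeneous equation to
`A X B = C Y D`, `Ā Y B̄ = C̄ X D̄`, and `(X, Y) ↦ (Ȳ, X̄)` is a conjugation on the solutions of this
system, so the two have nonzero solutions at the same time
(`conjSylvester_injective_iff_system`).

For `Z = [[0, X], [Y, 0]]` the system says `M₁ Z N₂ = N₁ Z M₂`, where `M₁ + λ N₁` and `M₂ + λ N₂` are
the two pencils. If both are regular, some `t` makes `R = M₁ + t N₁` and `S = M₂ + t N₂` invertible,
and the equation becomes the Sylvester equation `(R⁻¹ N₁) Z = Z (N₂ S⁻¹)`. Its two coefficients have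
disjoint spectra when the pencils do, and then `Z = 0`
(`MatrixPencil.eq_zero_of_mul_mul_eq`).

Conversely, a common eigenvalue `(α : β)`, in homogeneous coordinates, gives a right null vector
`(v₁, v₂)` of `α M₁ + β N₁` and a left null vector `(w₁, w₂)` of `α M₂ + β N₂`, and
`X = v₁ w₂ᵀ`, `Y = v₂ w₁ᵀ` solve the system. The block symmetry of the pencils allows one to choose
`v₁ ≠ 0` and `w₂ ≠ 0` (`exists_conjBlock_null_fst_ne_zero`), so this solution is nonzero. A
pencil that is not regular has every `(α : β)` as an eigenvalue, and a pencil of positive size has at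
least one eigenvalue, so failure of regularity also produces a common eigenvalue.
-/

open Matrix

/-! ### Entrywise conjugation -/

namespace Matrix

variable {l m n : Type*}

theorem entrywiseConj_entrywiseConj (A : Matrix m n ℂ) :
    A.entrywiseConj.entrywiseConj = A := by
  ext; simp [entrywiseConj]

theorem entrywiseConj_mul [Fintype m] (A : Matrix l m ℂ) (B : Matrix m n ℂ) :
    (A * B).entrywiseConj = A.entrywiseConj * B.entrywiseConj :=
  Matrix.map_mul

theorem entrywiseConj_add (A B : Matrix m n ℂ) :
    (A + B).entrywiseConj = A.entrywiseConj + B.entrywiseConj := by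
  ext; simp [entrywiseConj]

theorem entrywiseConj_sub (A B : Matrix m n ℂ) :
    (A - B).entrywiseConj = A.entrywiseConj - B.entrywiseConj := by
  ext; simp [entrywiseConj]

theorem entrywiseConj_smul (c : ℂ) (A : Matrix m n ℂ) :
    (c • A).entrywiseConj = (starRingEnd ℂ c) • A.entrywiseConj := by
  ext; simp [entrywiseConj]

theorem entrywiseConj_transpose (A : Matrix m n ℂ) : Aᵀ.entrywiseConj = A.entrywiseConjᵀ := rfl

theorem entrywiseConj_mulVec_star [Fintype n] (A : Matrix m n ℂ) (v : n → ℂ) :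
    A.entrywiseConj *ᵥ star v = star (A *ᵥ v) := by
  ext i; simp [entrywiseConj, mulVec, dotProduct]

/-! ### The Sylvester equation -/

variable [Fintype m] [DecidableEq m] [Fintype n] [DecidableEq n]

theorem aeval_mul_eq_mul_aeval {K : Matrix m m ℂ} {L : Matrix n n ℂ} {Z : Matrix m n ℂ}
    (h : K * Z = Z * L) (p : ℂ[X]) : Polynomial.aeval K p * Z = Z * Polynomial.aeval L p := by
  induction p using Polynomial.induction_on' with
  | add p q hp hq => simp [Matrix.add_mul, Matrix.mul_add, hp, hq]
  | monomial k a =>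
    have hk : K ^ k * Z = Z * L ^ k := by
      induction k with
      | zero => simp
      | succ k ih =>
        rw [pow_succ, pow_succ, Matrix.mul_assoc, h, ← Matrix.mul_assoc, ih, Matrix.mul_assoc]
    simp [Polynomial.aeval_monomial, Algebra.algebraMap_eq_smul_one, hk]

/-- Sylvester's uniqueness theorem: with `p` the characteristic polynomial of `L`, one gets
`p(K) Z = Z p(L) = 0`, and `p(K)` is invertible because no eigenvalue of `K` is a root of `p`. -/
theorem eq_zero_of_mul_eq_mul_of_disjoint_spectrum [Nonempty m]
    {K : Matrix m m ℂ} {L : Matrix n n ℂ} {Z : Matrix m n ℂ}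
    (hKL : ∀ μ, μ ∈ spectrum ℂ K → μ ∉ spectrum ℂ L) (h : K * Z = Z * L) : Z = 0 := by
  have h0 := aeval_mul_eq_mul_aeval h L.charpoly
  rw [aeval_self_charpoly, Matrix.mul_zero] at h0
  have hu : IsUnit (Polynomial.aeval K L.charpoly) := by
    rw [← spectrum.zero_notMem_iff (R := ℂ), spectrum.map_polynomial_aeval_of_nonempty _ _
      (spectrum.nonempty_of_isAlgClosed_of_finiteDimensional ℂ K)]
    rintro ⟨μ, hμ, hroot⟩
    exact hKL μ hμ (mem_spectrum_iff_isRoot_charpoly.2 hroot)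
  obtain ⟨u, hu⟩ := hu
  rw [← hu] at h0
  calc Z = (↑u⁻¹ * (u : Matrix m m ℂ)) * Z := by simp
    _ = 0 := by rw [Matrix.mul_assoc, h0, Matrix.mul_zero]

end Matrix

/-! ### Matrix pencils and their homogeneous eigenvalues -/

namespace MatrixPencil

variable {ι κ : Type*} [Fintype ι] [DecidableEq ι] [Fintype κ] [DecidableEq κ]

theorem eval_det_toPolyMatrix (P : MatrixPencil ι) (z : ℂ) :
    P.toPolyMatrix.det.eval z = (P.eval z).det := by
  rw [← Polynomial.coe_evalRingHom, RingHom.map_det]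
  congr 1
  ext i j
  simp [toPolyMatrix, eval, mul_comm z]

theorem det_N_eq_zero_of_not_isRegular {P : MatrixPencil ι} (h : ¬ P.IsRegular) :
    P.N.det = 0 := by
  rw [IsRegular, not_not] at h
  rw [← Polynomial.coeff_det_X_add_C_card P.N P.M, add_comm]
  exact (congrArg (fun p : ℂ[X] => p.coeff (Fintype.card ι)) h).trans
    (Polynomial.coeff_zero _)

theorem det_smul_add_smul {P : MatrixPencil ι} {α : ℂ} (hα : α ≠ 0) (β : ℂ) :
    (α • P.M + β • P.N).det = α ^ Fintype.card ι * (P.eval (β / α)).det := by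
  rw [← det_smul, eval, smul_add, smul_smul, mul_div_cancel₀ _ hα]

theorem det_smul_add_smul_eq_zero_of_not_isRegular [Nonempty ι] {P : MatrixPencil ι}
    (h : ¬ P.IsRegular) (α β : ℂ) : (α • P.M + β • P.N).det = 0 := by
  rcases eq_or_ne α 0 with rfl | hα
  · rw [zero_smul, zero_add, det_smul, det_N_eq_zero_of_not_isRegular h, mul_zero]
  · rw [det_smul_add_smul hα, ← eval_det_toPolyMatrix, not_not.1 h]
    simp

/-- A pencil of positive size has an eigenvalue in the projective line. -/
theorem exists_det_smul_add_smul_eq_zero [Nonempty ι] (P : MatrixPencil ι) :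
    ∃ α β : ℂ, (α ≠ 0 ∨ β ≠ 0) ∧ (α • P.M + β • P.N).det = 0 := by
  by_cases hN : P.N.det = 0
  · exact ⟨0, 1, by simp, by simpa using hN⟩
  · have hu : IsUnit P.N.det := isUnit_iff_ne_zero.2 hN
    obtain ⟨μ, hμ⟩ :=
      spectrum.nonempty_of_isAlgClosed_of_finiteDimensional ℂ (P.N⁻¹ * P.M)
    refine ⟨-1, μ, by simp, ?_⟩
    have h : (-1 : ℂ) • P.M + μ • P.N =
        P.N * (algebraMap ℂ (Matrix ι ι ℂ) μ - P.N⁻¹ * P.M) := by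
      rw [Matrix.mul_sub, mul_nonsing_inv_cancel_left _ _ hu, Algebra.algebraMap_eq_smul_one]
      simp [sub_eq_neg_add]
    rw [spectrum.mem_iff, isUnit_iff_isUnit_det, isUnit_iff_ne_zero, not_not] at hμ
    rw [h, det_mul, hμ, mul_zero]

/-- Disjointness of spectra in homogeneous coordinates. -/
theorem disjoint_spectrum_iff (P : MatrixPencil ι) (Q : MatrixPencil κ) :
    Disjoint P.spectrum Q.spectrum ↔ ∀ α β : ℂ, (α ≠ 0 ∨ β ≠ 0) →
      (α • P.M + β • P.N).det = 0 → (α • Q.M + β • Q.N).det ≠ 0 := by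
  rw [Set.disjoint_left]
  constructor
  · intro h α β hαβ hP hQ
    rcases eq_or_ne α 0 with rfl | hα
    · have hβ : β ≠ 0 := by simpa using hαβ
      have hP' : P.N.det = 0 := by simpa [det_smul, hβ] using hP
      have hQ' : Q.N.det = 0 := by simpa [det_smul, hβ] using hQ
      exact h (a := OnePoint.infty)
        (Or.inr ⟨rfl, by simp [isUnit_iff_isUnit_det, hP']⟩)
        (Or.inr ⟨rfl, by simp [isUnit_iff_isUnit_det, hQ']⟩)
    · rw [det_smul_add_smul hα, mul_eq_zero_iff_left (pow_ne_zero _ hα)] at hP hQ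
      exact h (a := ((β / α : ℂ) : OnePoint ℂ)) (Or.inl ⟨_, rfl, hP⟩) (Or.inl ⟨_, rfl, hQ⟩)
  · rintro h x (⟨z, rfl, hz⟩ | ⟨rfl, hz⟩) (⟨z', hx, hz'⟩ | ⟨hx, hz'⟩)
    · obtain rfl := OnePoint.coe_injective hx
      exact h 1 z (by simp) (by simpa [eval] using hz) (by simpa [eval] using hz')
    · exact OnePoint.coe_ne_infty z hx
    · exact OnePoint.infty_ne_coe z' hx
    · rw [isUnit_iff_isUnit_det, isUnit_iff_ne_zero, not_not] at hz hz'
      exact h 0 1 (by simp) (by simpa using hz) (by simpa using hz')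

/-- Two regular pencils are simultaneously invertible at some point, because the product of their
determinants is a nonzero polynomial over an infinite field. -/
theorem exists_det_eval_ne_zero {P : MatrixPencil ι} {Q : MatrixPencil κ}
    (hP : P.IsRegular) (hQ : Q.IsRegular) :
    ∃ t : ℂ, (P.eval t).det ≠ 0 ∧ (Q.eval t).det ≠ 0 := by
  by_contra! h
  refine mul_ne_zero hP hQ (Polynomial.funext fun t => ?_)
  rw [Polynomial.eval_mul, eval_det_toPolyMatrix, eval_det_toPolyMatrix, Polynomial.eval_zero]
  by_cases ht : (P.eval t).det = 0
  · rw [ht, zero_mul]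
  · rw [h t ht, mul_zero]

/-- Uniqueness for the generalized Sylvester equation. -/
theorem eq_zero_of_mul_mul_eq [Nonempty ι] {P : MatrixPencil ι} {Q : MatrixPencil κ}
    (hP : P.IsRegular) (hQ : Q.IsRegular) (hPQ : Disjoint P.spectrum Q.spectrum)
    {Z : Matrix ι κ ℂ} (hZ : P.M * Z * Q.N = P.N * Z * Q.M) : Z = 0 := by
  rw [disjoint_spectrum_iff] at hPQ
  obtain ⟨t, hR, hS⟩ := exists_det_eval_ne_zero hP hQ
  set R := P.eval t with hRdef
  set S := Q.eval t with hSdef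
  have hRu : IsUnit R.det := isUnit_iff_ne_zero.2 hR
  have hSu : IsUnit S.det := isUnit_iff_ne_zero.2 hS
  -- The terms in `t` added to the two sides are both `t • (P.N * Z * Q.N)`.
  have hRS : R * Z * Q.N = P.N * Z * S := by
    simp only [hRdef, hSdef, eval, Matrix.add_mul, Matrix.mul_add, hZ, Matrix.smul_mul,
      Matrix.mul_smul]
  refine eq_zero_of_mul_eq_mul_of_disjoint_spectrum (K := R⁻¹ * P.N) (L := Q.N * S⁻¹) ?_ ?_
  · intro μ hμP hμQ
    rw [spectrum.mem_iff, isUnit_iff_isUnit_det, isUnit_iff_ne_zero, not_not] at hμP hμQ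
    -- `μ` is an eigenvalue of `R⁻¹ N` exactly when `μ R - N = μ M + (μ t - 1) N` is singular.
    refine hPQ μ (μ * t - 1) ?_ ?_ ?_
    · rcases eq_or_ne μ 0 with rfl | h
      · simp
      · exact Or.inl h
    · have h : μ • P.M + (μ * t - 1) • P.N =
          R * (algebraMap ℂ (Matrix ι ι ℂ) μ - R⁻¹ * P.N) := by
        rw [Matrix.mul_sub, mul_nonsing_inv_cancel_left _ _ hRu, Algebra.algebraMap_eq_smul_one]
        simp only [hRdef, eval, Matrix.mul_smul, Matrix.mul_one]
        module
      rw [h, det_mul, hμP, mul_zero]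
    · have h : μ • Q.M + (μ * t - 1) • Q.N =
          (algebraMap ℂ (Matrix κ κ ℂ) μ - Q.N * S⁻¹) * S := by
        rw [Matrix.sub_mul, nonsing_inv_mul_cancel_right _ _ hSu, Algebra.algebraMap_eq_smul_one]
        simp only [hSdef, eval, Matrix.smul_mul, Matrix.one_mul]
        module
      rw [h, det_mul, hμQ, zero_mul]
  · calc R⁻¹ * P.N * Z = R⁻¹ * (P.N * Z * S) * S⁻¹ := by
          rw [← Matrix.mul_assoc R⁻¹, mul_nonsing_inv_cancel_right _ _ hSu, Matrix.mul_assoc]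
      _ = Z * (Q.N * S⁻¹) := by
          rw [← hRS, Matrix.mul_assoc R, nonsing_inv_mul_cancel_left _ _ hRu, Matrix.mul_assoc]

end MatrixPencil

/-! ### Null vectors of the conjugate block pencils -/

section NullVectors

variable {ι κ : Type*} [Fintype ι] [Fintype κ]

/-- A null vector `(0, v₂)` of `[[β C̄, α Ā], [α A, β C]]` yields the null vector `(v̄₂, 0)`: the block
equation `α Ā v₂ = 0` says that `α = 0` or `Ā v₂ = 0`, hence `α A v̄₂ = 0`, and likewise `β C v₂ = 0`
gives `β C̄ v̄₂ = 0`. In particular `α` and `β` need not be real. -/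
theorem exists_conjBlock_null_fst_ne_zero {A C : Matrix ι ι ℂ} {α β : ℂ} {v₁ v₂ : ι → ℂ}
    (hv : v₁ ≠ 0 ∨ v₂ ≠ 0)
    (h₁ : β • (C.entrywiseConj *ᵥ v₁) + α • (A.entrywiseConj *ᵥ v₂) = 0)
    (h₂ : α • (A *ᵥ v₁) + β • (C *ᵥ v₂) = 0) :
    ∃ u₁ u₂ : ι → ℂ, u₁ ≠ 0 ∧
      β • (C.entrywiseConj *ᵥ u₁) + α • (A.entrywiseConj *ᵥ u₂) = 0 ∧
      α • (A *ᵥ u₁) + β • (C *ᵥ u₂) = 0 := by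
  by_cases h : v₁ = 0
  · subst h
    have hv₂ : v₂ ≠ 0 := by simpa using hv
    refine ⟨star v₂, 0, by simpa using hv₂, ?_, ?_⟩
    · rw [mulVec_zero, smul_zero, add_zero, entrywiseConj_mulVec_star]
      simpa using h₂
    · rw [mulVec_zero, smul_zero, add_zero]
      have h := entrywiseConj_mulVec_star A.entrywiseConj v₂
      rw [entrywiseConj_entrywiseConj] at h
      rw [h]
      simpa using h₁
  · exact ⟨v₁, v₂, h, h₁, h₂⟩

theorem exists_conjBlock_null_snd_ne_zero {A C : Matrix ι ι ℂ} {α β : ℂ} {v₁ v₂ : ι → ℂ}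
    (hv : v₁ ≠ 0 ∨ v₂ ≠ 0)
    (h₁ : β • (C.entrywiseConj *ᵥ v₁) + α • (A.entrywiseConj *ᵥ v₂) = 0)
    (h₂ : α • (A *ᵥ v₁) + β • (C *ᵥ v₂) = 0) :
    ∃ u₁ u₂ : ι → ℂ, u₂ ≠ 0 ∧
      β • (C.entrywiseConj *ᵥ u₁) + α • (A.entrywiseConj *ᵥ u₂) = 0 ∧
      α • (A *ᵥ u₁) + β • (C *ᵥ u₂) = 0 := by
  obtain ⟨u₂, u₁, hu, e₁, e₂⟩ := exists_conjBlock_null_fst_ne_zero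
    (A := A.entrywiseConj) (C := C.entrywiseConj) hv.symm
    (by simpa only [entrywiseConj_entrywiseConj, add_comm] using h₂)
    (by rwa [add_comm])
  simp only [entrywiseConj_entrywiseConj] at e₁
  exact ⟨u₁, u₂, hu, by rwa [add_comm], by rwa [add_comm]⟩

theorem exists_conjBlock_null [DecidableEq ι] {A C : Matrix ι ι ℂ} {α β : ℂ}
    (h : (α • (conjBlockPencil C A.entrywiseConj A).M +
      β • (conjBlockPencil C A.entrywiseConj A).N).det = 0) :
    ∃ v₁ v₂ : ι → ℂ, (v₁ ≠ 0 ∨ v₂ ≠ 0) ∧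
      β • (C.entrywiseConj *ᵥ v₁) + α • (A.entrywiseConj *ᵥ v₂) = 0 ∧
      α • (A *ᵥ v₁) + β • (C *ᵥ v₂) = 0 := by
  obtain ⟨v, hv, hv0⟩ := exists_mulVec_eq_zero_iff.2 h
  refine ⟨v ∘ Sum.inl, v ∘ Sum.inr, ?_, ?_⟩
  · by_contra! hc
    refine hv (funext fun i => ?_)
    rcases i with i | i
    · exact congrFun hc.1 i
    · exact congrFun hc.2 i
  · simp only [conjBlockPencil, fromBlocks_smul, fromBlocks_add, smul_zero, zero_add, add_zero,
      fromBlocks_mulVec, smul_mulVec] at hv0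
    exact ⟨funext fun i => congrFun hv0 (Sum.inl i), funext fun i => congrFun hv0 (Sum.inr i)⟩

end NullVectors

theorem vecMulVec_eq_vecMulVec_of_smul_add_smul {ι κ : Type*} {α β : ℂ} (hαβ : α ≠ 0 ∨ β ≠ 0)
    {p q : ι → ℂ} {r s : κ → ℂ} (hpq : α • p + β • q = 0) (hsr : α • s + β • r = 0) :
    vecMulVec p r = vecMulVec q s := by
  ext i j
  have h₁ : α * p i + β * q i = 0 := congrFun hpq i
  have h₂ : α * s j + β * r j = 0 := congrFun hsr j
  rw [vecMulVec_apply, vecMulVec_apply]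
  rcases hαβ with h | h
  · exact mul_left_cancel₀ h (by linear_combination r j * h₁ - q i * h₂)
  · exact mul_left_cancel₀ h (by linear_combination p i * h₂ - s j * h₁)

/-! ### The conjugate-Sylvester operator and its complexification -/

section ConjSylvester

variable {ι κ : Type*} [Fintype ι] [Fintype κ]

/-- The real-linear operator `X ↦ A X B - C X̄ D`. -/
def conjSylvester (A C : Matrix ι ι ℂ) (B D : Matrix κ κ ℂ) :
    Matrix ι κ ℂ →ₗ[ℝ] Matrix ι κ ℂ where
  toFun X := A * X * B - C * X.entrywiseConj * D
  map_add' X Y := by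
    rw [entrywiseConj_add]
    simp only [Matrix.mul_add, Matrix.add_mul]
    abel
  map_smul' r X := by
    have h : (r • X).entrywiseConj = r • X.entrywiseConj := by
      ext; simp [entrywiseConj]
    simp [h, smul_sub]

theorem existsUnique_iff_conjSylvester_injective (A C : Matrix ι ι ℂ) (B D : Matrix κ κ ℂ)
    (E : Matrix ι κ ℂ) :
    (∃! X : Matrix ι κ ℂ, A * X * B - C * X.entrywiseConj * D = E) ↔
      Function.Injective (conjSylvester A C B D) := by
  constructor
  · rintro ⟨X, hX, hu⟩
    rw [← LinearMap.ker_eq_bot, LinearMap.ker_eq_bot']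
    intro Y hY
    have h : conjSylvester A C B D (X + Y) = E := by rw [map_add, hY, add_zero]; exact hX
    simpa using hu (X + Y) h
  · intro h
    exact (show Function.Bijective (conjSylvester A C B D) from
      ⟨h, LinearMap.injective_iff_surjective.1 h⟩).existsUnique E

/-- The real-linear operator is injective exactly when its complexification is. A solution
`(X, Y)` of the complexified system gives the elements `X + Ȳ` and `i (X - Ȳ)` of the kernel. -/
theorem conjSylvester_injective_iff_system (A C : Matrix ι ι ℂ) (B D : Matrix κ κ ℂ) :
    Function.Injective (conjSylvester A C B D) ↔
      ∀ X Y : Matrix ι κ ℂ, A * X * B = C * Y * D →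
        A.entrywiseConj * Y * B.entrywiseConj = C.entrywiseConj * X * D.entrywiseConj →
        X = 0 ∧ Y = 0 := by
  rw [← LinearMap.ker_eq_bot, LinearMap.ker_eq_bot']
  constructor
  · intro h X Y h₁ h₂
    have h₃ : A * Y.entrywiseConj * B = C * X.entrywiseConj * D := by
      simpa only [entrywiseConj_mul, entrywiseConj_entrywiseConj] using
        congrArg entrywiseConj h₂
    have hs : X + Y.entrywiseConj = 0 := by
      refine h _ ?_
      change A * (X + Y.entrywiseConj) * B - C * (X + Y.entrywiseConj).entrywiseConj * D = 0
      rw [entrywiseConj_add, entrywiseConj_entrywiseConj]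
      simp only [Matrix.mul_add, Matrix.add_mul, h₁, h₃]
      abel
    have hd : Complex.I • (X - Y.entrywiseConj) = 0 := by
      refine h _ ?_
      change A * (Complex.I • (X - Y.entrywiseConj)) * B -
        C * (Complex.I • (X - Y.entrywiseConj)).entrywiseConj * D = 0
      rw [entrywiseConj_smul, entrywiseConj_sub, entrywiseConj_entrywiseConj, Complex.conj_I]
      simp only [Matrix.mul_sub, Matrix.sub_mul, Matrix.mul_smul, Matrix.smul_mul, h₁, h₃]
      module
    have hd' : X - Y.entrywiseConj = 0 := (smul_eq_zero_iff_right Complex.I_ne_zero).1 hd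
    have hX : X = 0 := by
      have h2 : (2 : ℂ) • X = 0 := by
        calc (2 : ℂ) • X = (X + Y.entrywiseConj) + (X - Y.entrywiseConj) := by module
          _ = 0 := by rw [hs, hd', add_zero]
      exact (smul_eq_zero_iff_right two_ne_zero).1 h2
    refine ⟨hX, ?_⟩
    rw [hX, zero_add] at hs
    rw [← entrywiseConj_entrywiseConj Y, hs]
    ext; simp [entrywiseConj]
  · intro h X hX
    have h₁ : A * X * B = C * X.entrywiseConj * D := sub_eq_zero.1 hX
    refine (h X X.entrywiseConj h₁ ?_).1
    simpa only [entrywiseConj_mul, entrywiseConj_entrywiseConj] using congrArg entrywiseConj h₁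

variable [DecidableEq ι] [DecidableEq κ]

theorem system_eq_zero_of_disjoint_spectrum [Nonempty ι] {A C : Matrix ι ι ℂ}
    {B D : Matrix κ κ ℂ}
    (hP : (conjBlockPencil C A.entrywiseConj A).IsRegular)
    (hQ : (conjBlockPencil B D D.entrywiseConj).IsRegular)
    (hPQ : Disjoint (conjBlockPencil C A.entrywiseConj A).spectrum
      (conjBlockPencil B D D.entrywiseConj).spectrum)
    {X Y : Matrix ι κ ℂ} (h₁ : A * X * B = C * Y * D)
    (h₂ : A.entrywiseConj * Y * B.entrywiseConj = C.entrywiseConj * X * D.entrywiseConj) :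
    X = 0 ∧ Y = 0 := by
  have hZ : fromBlocks 0 X Y 0 = (0 : Matrix (ι ⊕ ι) (κ ⊕ κ) ℂ) := by
    refine MatrixPencil.eq_zero_of_mul_mul_eq hP hQ hPQ ?_
    simp [conjBlockPencil, fromBlocks_multiply, h₁, h₂]
  rw [← fromBlocks_zero, fromBlocks_inj] at hZ
  exact ⟨hZ.2.1, hZ.2.2.1⟩

/-- The rank-one construction: a common homogeneous eigenvalue of the two pencils yields a nonzero
solution of the complexified system. -/
theorem exists_system_solution_of_common_eigenvalue {A C : Matrix ι ι ℂ} {B D : Matrix κ κ ℂ}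
    {α β : ℂ} (hαβ : α ≠ 0 ∨ β ≠ 0)
    (hP : (α • (conjBlockPencil C A.entrywiseConj A).M +
      β • (conjBlockPencil C A.entrywiseConj A).N).det = 0)
    (hQ : (α • (conjBlockPencil B D D.entrywiseConj).M +
      β • (conjBlockPencil B D D.entrywiseConj).N).det = 0) :
    ∃ X Y : Matrix ι κ ℂ, X ≠ 0 ∧ A * X * B = C * Y * D ∧
      A.entrywiseConj * Y * B.entrywiseConj = C.entrywiseConj * X * D.entrywiseConj := by
  -- Left null vectors of the second pencil are right null vectors of its transpose, which is the
  -- pencil of the first kind built from `Dᵀ` and `Bᵀ`.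
  have hQ' : (α • (conjBlockPencil Bᵀ Dᵀ.entrywiseConj Dᵀ).M +
      β • (conjBlockPencil Bᵀ Dᵀ.entrywiseConj Dᵀ).N).det = 0 := by
    rw [← det_transpose] at hQ
    simpa [conjBlockPencil, fromBlocks_transpose, entrywiseConj_transpose] using hQ
  obtain ⟨v₁, v₂, hv, p₁, p₂⟩ := exists_conjBlock_null hP
  obtain ⟨v₁, v₂, hv, p₁, p₂⟩ := exists_conjBlock_null_fst_ne_zero hv p₁ p₂
  obtain ⟨w₁, w₂, hw, q₁, q₂⟩ := exists_conjBlock_null hQ'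
  obtain ⟨w₁, w₂, hw, q₁, q₂⟩ := exists_conjBlock_null_snd_ne_zero hw q₁ q₂
  simp only [entrywiseConj_transpose, mulVec_transpose] at q₁ q₂
  refine ⟨vecMulVec v₁ w₂, vecMulVec v₂ w₁, ?_, ?_, ?_⟩
  · obtain ⟨i, hi⟩ := Function.ne_iff.1 hv
    obtain ⟨j, hj⟩ := Function.ne_iff.1 hw
    exact fun h => mul_ne_zero hi hj (congrFun (congrFun h i) j)
  · simp only [mul_vecMulVec, vecMulVec_mul]
    exact vecMulVec_eq_vecMulVec_of_smul_add_smul hαβ p₂ q₂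
  · simp only [mul_vecMulVec, vecMulVec_mul]
    exact vecMulVec_eq_vecMulVec_of_smul_add_smul hαβ (by rwa [add_comm]) (by rwa [add_comm])

end ConjSylvester

/-! ### The solvability criterion -/

theorem mainTheorem3 (m n : ℕ) (hm : 0 < m) (hn : 0 < n)
    (A C : Matrix (Fin m) (Fin m) ℂ) (B D : Matrix (Fin n) (Fin n) ℂ)
    (E : Matrix (Fin m) (Fin n) ℂ) :
    (∃! X : Matrix (Fin m) (Fin n) ℂ, A * X * B - C * X.entrywiseConj * D = E) ↔
      (conjBlockPencil C A.entrywiseConj A).IsRegular ∧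
      (conjBlockPencil B D D.entrywiseConj).IsRegular ∧
      Disjoint (conjBlockPencil C A.entrywiseConj A).spectrum
        (conjBlockPencil B D D.entrywiseConj).spectrum := by
  have : Nonempty (Fin m) := ⟨⟨0, hm⟩⟩
  have : Nonempty (Fin n) := ⟨⟨0, hn⟩⟩
  rw [existsUnique_iff_conjSylvester_injective, conjSylvester_injective_iff_system]
  constructor
  · intro h
    have hdisj : ∀ α β : ℂ, (α ≠ 0 ∨ β ≠ 0) →
        (α • (conjBlockPencil C A.entrywiseConj A).M +
          β • (conjBlockPencil C A.entrywiseConj A).N).det = 0 →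
        (α • (conjBlockPencil B D D.entrywiseConj).M +
          β • (conjBlockPencil B D D.entrywiseConj).N).det ≠ 0 := by
      intro α β hαβ hP hQ
      obtain ⟨X, Y, hX, h₁, h₂⟩ := exists_system_solution_of_common_eigenvalue hαβ hP hQ
      exact hX (h X Y h₁ h₂).1
    refine ⟨?_, ?_, (MatrixPencil.disjoint_spectrum_iff _ _).2 hdisj⟩
    · by_contra hreg
      obtain ⟨α, β, hαβ, hQ⟩ := MatrixPencil.exists_det_smul_add_smul_eq_zero
        (conjBlockPencil B D D.entrywiseConj)
      exact hdisj α β hαβ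
        (MatrixPencil.det_smul_add_smul_eq_zero_of_not_isRegular hreg α β) hQ
    · by_contra hreg
      obtain ⟨α, β, hαβ, hP⟩ := MatrixPencil.exists_det_smul_add_smul_eq_zero
        (conjBlockPencil C A.entrywiseConj A)
      exact hdisj α β hαβ hP
        (MatrixPencil.det_smul_add_smul_eq_zero_of_not_isRegular hreg α β)
  · rintro ⟨hP, hQ, hPQ⟩ X Y h₁ h₂
    exact system_eq_zero_of_disjoint_spectrum hP hQ hPQ h₁ h₂
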